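/- Let $X$ be a Grothendieck category (an abelian category with a generator in which small filtered colimits are exact) such that small products are exact in $X$ (condition (AB4*)). All subcategories are full. A subcategory of a Grothendieck category is *weakly closed* if it is closed under subobjects, quotient objects and small direct sums, and *closed* if it is weakly closed and closed under small products. It is *localizing* if it is weakly closed and closed under extensions. The subcategory *generated* by a class $S$ of objects consists of all quotient objects of small direct sums of objects of $S$. Let $Y$ be a localizing subcategory of $X$, let $\pi : X \to X/Y$ be the quotient functor (inverting exactly the morphisms with kernel and cokernel in $Y$), and let $\omega : X/Y \to X$ be its right adjoint. An object of $X$ is *$Y$-torsionfree* if its largest subobject in $Y$ is $0$. A subcategory $Z$ of $X$ is *$Y$-essentially stable* if $\omega\pi(M) \in Z$ for every $M \in Z$; it is *$Y$-torsionfree generated* if it is generated by the $Y$-torsionfree objects it contains; and it is *$Y$-closed* if it is closed, $Y$-essentially stable and $Y$-torsionfree generated. For a subcategory $Z$ of $X$, let $\pi(Z)$ be the subcategory of all objects of $X/Y$ isomorphic to $\pi(M)$ for some $M \in Z$. For a subcategory $\mathcal{Z}$ of $X/Y$, let $\psi(\mathcal{Z})$ be the subcategory of $X$ generated by all $Y$-torsionfree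 objects $M \in X$ with $\pi(M) \in \mathcal{Z}$. Then: 1. If $Z$ is a closed, $Y$-essentially stable subcategory of $X$, then $\pi(Z)$ is a closed subcategory of $X/Y$. 2. If $\mathcal{Z}$ is a closed subcategory of $X/Y$, then $\psi(\mathcal{Z})$ is a $Y$-closed subcategory of $X$. 3. The maps $Z \mapsto \pi(Z)$ and $\mathcal{Z} \mapsto \psi(\mathcal{Z})$ are mutually inverse bijections between the $Y$-closed subcategories of $X$ and the closed subcategories of $X/Y$. -/

import Mathlib

open CategoryTheory Limits

universe w v u

namespace CategoryTheory.ObjectProperty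

/-- A full subcategory `Z` is weakly closed if it is closed under subobjects, quotient objects, and
direct sums indexed by small sets, i.e. by types in `Type w`. (The index may be empty, so a weakly
closed subcategory of an abelian category contains the zero objects.) -/
class IsWeaklyClosed {E : Type u} [Category.{v} E] (Z : ObjectProperty E) : Prop where
  subobjects : Z.IsClosedUnderSubobjects
  quotients : Z.IsClosedUnderQuotients
  directSums (J : Type w) : Z.IsClosedUnderColimitsOfShape (Discrete J)

/-- A weakly closed full subcategory is closed if it is also closed under products indexed by small
sets. -/
class IsClosedSubcategory {E : Type u} [Category.{v} E] (Z : ObjectProperty E) :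
    Prop extends IsWeaklyClosed.{w} Z where
  products (J : Type w) : Z.IsClosedUnderLimitsOfShape (Discrete J)

variable {X : Type u} [Category.{v} X] [Abelian X]

/-- A full subcategory `Y` is localizing if it is weakly closed and closed under extensions. -/
class IsLocalizing (Y : ObjectProperty X) : Prop extends IsWeaklyClosed.{v} Y where
  extensions : Y.IsClosedUnderExtensions

instance isSerreClass_of_isLocalizing (Y : ObjectProperty X) [hY : Y.IsLocalizing] :
    Y.IsSerreClass where
  exists_zero := by
    have := hY.directSums PEmpty
    let F : Discrete PEmpty.{v + 1} ⥤ X := Discrete.functor PEmpty.elim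
    obtain ⟨A, hA⟩ := HasZeroObject.zero (C := X)
    let c : Cocone F := ⟨A, ⟨fun j => j.as.elim, fun j => j.as.elim⟩⟩
    have hc : IsColimit c := ⟨fun s => 0, fun s j => j.as.elim, fun s m _ => hA.eq_of_src m 0⟩
    exact ⟨A, hA, Y.prop_of_isColimit hc fun j => j.as.elim⟩
  toIsClosedUnderSubobjects := hY.subobjects
  toIsClosedUnderQuotients := hY.quotients
  toIsClosedUnderExtensions := hY.extensions

/-- The quotient category `X/Y`: the localization of `X` with respect to the morphisms whose kernel
and cokernel belong to `Y`. -/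
abbrev QuotientCategory (Y : ObjectProperty X) [Y.IsLocalizing] : Type u :=
  Y.isoModSerre.Localization

/-- The quotient functor `π : X ⥤ X/Y`. -/
abbrev quotientFunctor (Y : ObjectProperty X) [Y.IsLocalizing] : X ⥤ Y.QuotientCategory :=
  Y.isoModSerre.Q

section SectionFunctor

variable [IsGrothendieckAbelian.{v} X] (Y : ObjectProperty X) [Y.IsLocalizing]

lemma isoModSerre_colim_map {J : Type v} {F G : Discrete J ⥤ X} (α : F ⟶ G)
    (hα : ∀ j, Y.isoModSerre (α.app j)) : Y.isoModSerre (colim.map α) := by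
  have hY : IsWeaklyClosed.{v} Y := inferInstance
  have := hY.directSums J
  constructor
  · refine Y.prop_of_iso (PreservesKernel.iso colim α) (Y.prop_colimit _ fun j => ?_)
    exact Y.prop_of_iso (PreservesKernel.iso ((evaluation _ _).obj j) α).symm (hα j).1
  · refine Y.prop_of_iso (PreservesCokernel.iso colim α) (Y.prop_colimit _ fun j => ?_)
    exact Y.prop_of_iso (PreservesCokernel.iso ((evaluation _ _).obj j) α).symm (hα j).2

lemma quotientFunctor_hom_ext {J : Type v} (K : J → X) {T : Y.QuotientCategory}
    (f g : Y.quotientFunctor.obj (∐ K) ⟶ T)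
    (h : ∀ j, Y.quotientFunctor.map (Limits.Sigma.ι K j) ≫ f = Y.quotientFunctor.map (Limits.Sigma.ι K j) ≫ g) :
    f = g := by
  have hY : IsWeaklyClosed.{v} Y := inferInstance
  have := hY.directSums J
  have := Localization.essSurj Y.quotientFunctor Y.isoModSerre
  let e := Y.quotientFunctor.objObjPreimageIso T
  obtain ⟨φ, hφ⟩ := Localization.exists_leftFraction Y.quotientFunctor Y.isoModSerre
    ((f - g) ≫ e.inv)
  have hinv := Localization.inverts Y.quotientFunctor Y.isoModSerre
  have hs : IsIso (Y.quotientFunctor.map φ.s) := hinv _ φ.hs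
  have h1 : ∀ j, Y (Abelian.image (Limits.Sigma.ι K j ≫ φ.f)) := fun j => by
    rw [← SerreClassLocalization.map_eq_zero_iff Y.quotientFunctor Y, Functor.map_comp,
      ← φ.map_comp_map_s Y.quotientFunctor hinv, ← hφ]
    simp only [Preadditive.sub_comp, Preadditive.comp_sub, Category.assoc, reassoc_of% (h j),
      sub_self]
  have h2 : Y (Abelian.image φ.f) := by
    let m : ∐ (fun j => Abelian.image (Limits.Sigma.ι K j ≫ φ.f)) ⟶ Abelian.image φ.f :=
      Limits.Sigma.desc fun j => kernel.lift _ (Abelian.image.ι (Limits.Sigma.ι K j ≫ φ.f)) (by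
        rw [← cancel_epi (Abelian.factorThruImage (Limits.Sigma.ι K j ≫ φ.f))]
        simp)
    have hm : Limits.Sigma.map (fun j => Abelian.factorThruImage (Limits.Sigma.ι K j ≫ φ.f)) ≫ m =
        Abelian.factorThruImage φ.f := by
      rw [← cancel_mono (Abelian.image.ι φ.f)]
      refine Limits.Sigma.hom_ext _ _ fun j => ?_
      simp [m]
    have : Epi m := epi_of_epi_fac hm
    exact Y.prop_of_epi m (Y.prop_colimit _ fun j => h1 j.as)
  rw [← SerreClassLocalization.map_eq_zero_iff Y.quotientFunctor Y,
    ← φ.map_comp_map_s Y.quotientFunctor hinv, ← hφ] at h2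
  rw [← sub_eq_zero, ← cancel_mono e.inv, ← cancel_mono (Y.quotientFunctor.map φ.s), h2]
  simp

lemma quotientFunctor_exists_desc {J : Type v} (K : J → X) {T : Y.QuotientCategory}
    (f : ∀ j, Y.quotientFunctor.obj (K j) ⟶ T) :
    ∃ g : Y.quotientFunctor.obj (∐ K) ⟶ T, ∀ j, Y.quotientFunctor.map (Limits.Sigma.ι K j) ≫ g = f j := by
  have := Localization.essSurj Y.quotientFunctor Y.isoModSerre
  let e := Y.quotientFunctor.objObjPreimageIso T
  have hinv := Localization.inverts Y.quotientFunctor Y.isoModSerre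
  choose φ hφ using fun j => Localization.exists_rightFraction Y.quotientFunctor Y.isoModSerre
    (f j ≫ e.inv)
  let s : ∐ (fun j => (φ j).X') ⟶ ∐ K := Limits.Sigma.map fun j => (φ j).s
  have hs : IsIso (Y.quotientFunctor.map s) :=
    hinv _ (Y.isoModSerre_colim_map (F := Discrete.functor fun j => (φ j).X')
      (G := Discrete.functor K) (Discrete.natTrans fun j => (φ j.as).s) fun j => (φ j.as).hs)
  refine ⟨inv (Y.quotientFunctor.map s) ≫ Y.quotientFunctor.map (Limits.Sigma.desc fun j => (φ j).f) ≫
    e.hom, fun j => ?_⟩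
  have hj : IsIso (Y.quotientFunctor.map (φ j).s) := hinv _ (φ j).hs
  rw [← cancel_epi (Y.quotientFunctor.map (φ j).s), ← cancel_mono e.inv]
  simp only [Category.assoc]
  rw [← Functor.map_comp_assoc, hφ, (φ j).map_s_comp_map]
  have : (φ j).s ≫ Limits.Sigma.ι K j = Limits.Sigma.ι (fun j => (φ j).X') j ≫ s := by simp [s]
  rw [this, Functor.map_comp_assoc, IsIso.hom_inv_id_assoc]
  simp [← Functor.map_comp]

instance quotientFunctor_preservesColimits : PreservesColimitsOfSize.{v, v} Y.quotientFunctor := by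
  have := SerreClassLocalization.preservesFiniteColimits Y.quotientFunctor Y
  have (J : Type v) : PreservesColimitsOfShape (Discrete J) Y.quotientFunctor := by
    have (K : J → X) : PreservesColimit (Discrete.functor K) Y.quotientFunctor := by
      refine preservesColimit_of_preserves_colimit_cocone (coproductIsCoproduct K)
        ((isColimitMapCoconeCofanMkEquiv _ _ _).symm ?_)
      refine Cofan.IsColimit.mk _
        (fun t => (Y.quotientFunctor_exists_desc K t.inj).choose)
        (fun t => (Y.quotientFunctor_exists_desc K t.inj).choose_spec)
        (fun t m hm => Y.quotientFunctor_hom_ext K _ _ fun j => (hm j).trans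
          ((Y.quotientFunctor_exists_desc K t.inj).choose_spec j).symm)
    exact preservesColimitsOfShape_of_discrete _
  exact preservesColimits_of_preservesCoequalizers_and_coproducts.{v} _

lemma quotientFunctor_exists_fac {M N : X} (f : Y.quotientFunctor.obj M ⟶ Y.quotientFunctor.obj N) :
    ∃ (A : X) (m : A ⟶ M) (_ : Mono m) (_ : Y.isoModSerre m) (B : X) (q : N ⟶ B) (_ : Epi q)
      (_ : Y.isoModSerre q) (h : A ⟶ B),
      Y.quotientFunctor.map m ≫ f ≫ Y.quotientFunctor.map q = Y.quotientFunctor.map h := by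
  obtain ⟨φ, hφ⟩ := Localization.exists_rightFraction Y.quotientFunctor Y.isoModSerre f
  have hinv := Localization.inverts Y.quotientFunctor Y.isoModSerre
  have hk : kernel.ι (Abelian.factorThruImage φ.s) ≫ φ.s = 0 :=
    (_ ≫= (Abelian.image.fac φ.s).symm).trans
      (by rw [← Category.assoc, kernel.condition, zero_comp])
  have h0 : kernel.ι (Abelian.factorThruImage φ.s) ≫ φ.f ≫ cokernel.π (kernel.ι φ.s ≫ φ.f) = 0 := by
    rw [← kernel.lift_ι φ.s _ hk, Category.assoc, ← Category.assoc (kernel.ι φ.s),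
      cokernel.condition, comp_zero]
  have hq : Y.isoModSerre (cokernel.π (kernel.ι φ.s ≫ φ.f)) := by
    rw [isoModSerre_iff_of_epi]
    exact Y.prop_of_epi (Abelian.factorThruImage (kernel.ι φ.s ≫ φ.f)) φ.hs.1
  refine ⟨_, Abelian.image.ι φ.s, inferInstance, φ.hs.2.isoModSerre_image_ι, _,
    cokernel.π (kernel.ι φ.s ≫ φ.f), inferInstance, hq,
    Abelian.epiDesc (Abelian.factorThruImage φ.s) _ h0, ?_⟩
  have : IsIso (Y.quotientFunctor.map (Abelian.factorThruImage φ.s)) :=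
    hinv _ φ.hs.1.isoModSerre_factorThruImage
  rw [← cancel_epi (Y.quotientFunctor.map (Abelian.factorThruImage φ.s)), ← Functor.map_comp,
    Abelian.comp_epiDesc, ← Functor.map_comp_assoc, Abelian.image.fac, hφ,
    φ.map_s_comp_map_assoc, Functor.map_comp]

instance quotientCategory_locallySmall : LocallySmall.{v} Y.QuotientCategory := by
  have := Localization.essSurj Y.quotientFunctor Y.isoModSerre
  have hinv := Localization.inverts Y.quotientFunctor Y.isoModSerre
  have key (M N : X) : Small.{v} (Y.quotientFunctor.obj M ⟶ Y.quotientFunctor.obj N) := by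
    classical
    let F : (Σ (S : Subobject M) (T : Subobject (Opposite.op N)), (S : X) ⟶ (T : Xᵒᵖ).unop) →
        (Y.quotientFunctor.obj M ⟶ Y.quotientFunctor.obj N) := fun a =>
      if h : IsIso (Y.quotientFunctor.map a.1.arrow) ∧
          IsIso (Y.quotientFunctor.map a.2.1.arrow.unop) then
        have := h.1
        have := h.2
        inv (Y.quotientFunctor.map a.1.arrow) ≫ Y.quotientFunctor.map a.2.2 ≫
          inv (Y.quotientFunctor.map a.2.1.arrow.unop)
      else 0
    refine small_of_surjective (f := F) fun f => ?_
    obtain ⟨A, m, hm, hm', B, q, hq, hq', h, fac⟩ := Y.quotientFunctor_exists_fac f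
    let i := Subobject.underlyingIso m
    let j := (Subobject.underlyingIso q.op).unop
    have hi : i.hom ≫ m = (Subobject.mk m).arrow := Subobject.underlyingIso_hom_comp_eq_mk m
    have hj : q ≫ j.hom = (Subobject.mk q.op).arrow.unop :=
      Quiver.Hom.op_inj (Subobject.underlyingIso_hom_comp_eq_mk q.op)
    have h1 := hinv _ hm'
    have h2 := hinv _ hq'
    have h3 : IsIso (Y.quotientFunctor.map (Subobject.mk m).arrow) := by
      rw [← hi, Functor.map_comp]; infer_instance
    have h4 : IsIso (Y.quotientFunctor.map (Subobject.mk q.op).arrow.unop) := by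
      rw [← hj, Functor.map_comp]; infer_instance
    refine ⟨⟨Subobject.mk m, Subobject.mk q.op, i.hom ≫ h ≫ j.hom⟩, ?_⟩
    dsimp only [F]
    rw [dif_pos ⟨h3, h4⟩, IsIso.inv_comp_eq, IsIso.comp_inv_eq, ← hi, ← hj]
    simp only [Functor.map_comp, ← fac, Category.assoc]
  refine ⟨fun S T => ?_⟩
  have := key (Y.quotientFunctor.objPreimage S) (Y.quotientFunctor.objPreimage T)
  exact small_of_injective (Iso.homCongr (Y.quotientFunctor.objObjPreimageIso S).symm
    (Y.quotientFunctor.objObjPreimageIso T).symm).injective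

instance quotientFunctor_isLeftAdjoint : Y.quotientFunctor.IsLeftAdjoint := by
  let e := ShrinkHoms.equivalence.{v} Y.QuotientCategory
  have : PreservesColimitsOfSize.{v, v} (Y.quotientFunctor ⋙ e.functor) := inferInstance
  have : (Y.quotientFunctor ⋙ e.functor).IsLeftAdjoint :=
    isLeftAdjoint_of_preservesColimits_of_isSeparating (isSeparator_separator X) _
  exact Functor.isLeftAdjoint_of_iso (F := (Y.quotientFunctor ⋙ e.functor) ⋙ e.inverse)
    (Functor.associator _ _ _ ≪≫ Functor.isoWhiskerLeft _ e.unitIso.symm ≪≫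
      Functor.rightUnitor _)

/-- The section functor `ω : X/Y ⥤ X`, i.e. the right adjoint of the quotient functor. -/
noncomputable def sectionFunctor : Y.QuotientCategory ⥤ X :=
  Y.quotientFunctor.rightAdjoint

/-- The adjunction `π ⊣ ω`. -/
noncomputable def quotientSectionAdjunction : Y.quotientFunctor ⊣ Y.sectionFunctor :=
  Adjunction.ofIsLeftAdjoint Y.quotientFunctor

end SectionFunctor

/-- An object `M` is `Y`-torsionfree if its largest subobject in `Y` is zero, i.e. if every
subobject of `M` that belongs to `Y` is zero. -/
def torsionFree (Y : ObjectProperty X) : ObjectProperty X :=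
  fun M => ∀ (K : X) (i : K ⟶ M) [Mono i], Y K → IsZero K

variable [IsGrothendieckAbelian.{v} X]

/-- The full subcategory generated by the objects satisfying `S`: all quotient objects of small
direct sums of objects satisfying `S`. -/
def generatedBy (S : ObjectProperty X) : ObjectProperty X :=
  fun M => ∃ (J : Type v) (K : J → X) (p : ∐ K ⟶ M), (∀ j, S (K j)) ∧ Epi p

/-- `Z` is `Y`-torsionfree generated: it is the full subcategory generated by the `Y`-torsionfree
objects that it contains. -/
def IsTorsionFreeGenerated (Y Z : ObjectProperty X) : Prop :=
  generatedBy (Y.torsionFree ⊓ Z) = Z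

variable (Y : ObjectProperty X) [Y.IsLocalizing]

/-- `Z` is `Y`-essentially stable: `ω(π(M))` belongs to `Z` for all `M` in `Z`. -/
def IsEssentiallyStable (Z : ObjectProperty X) : Prop :=
  ∀ M, Z M → Z (Y.sectionFunctor.obj (Y.quotientFunctor.obj M))

/-- `Z` is `Y`-closed: it is closed, `Y`-essentially stable and `Y`-torsionfree generated. -/
structure IsRelativelyClosed (Z : ObjectProperty X) : Prop where
  closed : IsClosedSubcategory.{v} Z
  essentiallyStable : Y.IsEssentiallyStable Z
  torsionFreeGenerated : Y.IsTorsionFreeGenerated Z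

/-- `π(Z)`: the full subcategory of `X/Y` of the objects isomorphic to `π(M)` for some `M` in
`Z`. -/
def quotientImage (Z : ObjectProperty X) : ObjectProperty Y.QuotientCategory :=
  Z.map Y.quotientFunctor

/-- The full subcategory of `X` generated by the `Y`-torsionfree objects `M` such that `π(M)`
belongs to `Z`. -/
def torsionFreeLift (Z : ObjectProperty Y.QuotientCategory) : ObjectProperty X :=
  generatedBy (Y.torsionFree ⊓ Z.inverseImage Y.quotientFunctor)

end CategoryTheory.ObjectProperty

/-! The counit `π ω ⟶ 𝟭` is invertible, every `ω(T)` is `Y`-torsionfree, and the unit embeds every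
torsionfree `M` in `ω(π(M))`.

For essentially stable `Z` closed under isomorphisms, `T` lies in `π(Z)` exactly when `ω(T)` lies in
`Z`. Since `ω` preserves monomorphisms and products, `π(Z)` inherits closure under subobjects and
products; sums and quotients are handled by `π`, which is exact and preserves colimits.

Conversely, the torsionfree objects with image in a closed subcategory of `X/Y` are stable under
subobjects, sums and products. Passing to their quotients keeps these closure properties; only
products need (AB4*).

The two maps are inverse because a `Y`-closed `Z` is generated by its torsionfree objects, and a
torsionfree `M` with `π(M)` in `π(Z)` embeds in `ω(π(M))`, which lies in `Z`. -/

namespace CategoryTheory.ObjectProperty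

/-! ### Generated subcategories and their closure properties -/

section Generated

variable {X : Type u} [Category.{v} X] [Abelian X] [IsGrothendieckAbelian.{v} X]
  (S : ObjectProperty X)

lemma le_generatedBy : S ≤ generatedBy S := fun M hM =>
  ⟨PUnit, fun _ => M, Limits.Sigma.desc fun _ => 𝟙 M, fun _ => hM,
    epi_of_epi_fac (Limits.Sigma.ι_desc (fun _ : PUnit.{v + 1} => 𝟙 M) PUnit.unit)⟩

lemma generatedBy_le {Z : ObjectProperty X} [hZ : IsWeaklyClosed.{v} Z] (h : S ≤ Z) :
    generatedBy S ≤ Z := by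
  rintro M ⟨J, K, p, hK, _⟩
  have := hZ.directSums J
  have := hZ.quotients
  exact Z.prop_of_epi p (Z.prop_colimit _ fun j => h _ (hK j.as))

lemma generatedBy_monotone {S S' : ObjectProperty X} (h : S ≤ S') :
    generatedBy S ≤ generatedBy S' := by
  rintro M ⟨J, K, p, hK, hp⟩
  exact ⟨J, K, p, fun j => h _ (hK j), hp⟩

variable {S}

lemma generatedBy_of_epi {N M : X} (p : N ⟶ M) [Epi p] (hN : S N) : generatedBy S M := by
  obtain ⟨J, K, q, hK, _⟩ := le_generatedBy S N hN
  exact ⟨J, K, q ≫ p, hK, epi_comp _ _⟩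

lemma generatedBy_iff (hS : ∀ J : Type v, S.IsClosedUnderColimitsOfShape (Discrete J)) {M : X} :
    generatedBy S M ↔ ∃ (N : X) (p : N ⟶ M), S N ∧ Epi p := by
  refine ⟨?_, fun ⟨N, p, hN, hp⟩ => generatedBy_of_epi p hN⟩
  rintro ⟨J, K, p, hK, hp⟩
  have := hS J
  exact ⟨_, p, S.prop_colimit _ fun j => hK j.as, hp⟩

lemma isWeaklyClosed_generatedBy [S.IsClosedUnderSubobjects]
    (hS : ∀ J : Type v, S.IsClosedUnderColimitsOfShape (Discrete J)) :
    IsWeaklyClosed.{v} (generatedBy S) where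
  subobjects := ⟨fun {M N} f _ hN => by
    obtain ⟨T, p, hT, _⟩ := (generatedBy_iff hS).1 hN
    -- The pullback of the cover `p` along `f` is a subobject of `T`, and it still covers `M`.
    exact generatedBy_of_epi (pullback.fst f p) (S.prop_of_mono (pullback.snd f p) hT)⟩
  quotients := ⟨fun {M N} f _ hM => by
    obtain ⟨T, p, hT, _⟩ := (generatedBy_iff hS).1 hM
    exact generatedBy_of_epi (p ≫ f) hT⟩
  directSums J := ⟨fun M ⟨P, hP⟩ => by
    choose T p hT hp using fun j => (generatedBy_iff hS).1 (hP j)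
    have := hS J
    let α : Discrete.functor (fun j => T ⟨j⟩) ⟶ P.diag := Discrete.natTrans fun j => p j
    have : ∀ j, Epi (α.app j) := fun j => hp j
    have : Epi α := NatTrans.epi_of_epi_app α
    let q := (colimit.isColimit (Discrete.functor fun j => T ⟨j⟩)).map (Cocone.mk M P.ι) α
    have : Epi q := ⟨fun {W} g h e => P.isColimit.hom_ext fun j => by
      rw [← cancel_epi (α.app j)]
      have := colimit.ι (Discrete.functor fun j => T ⟨j⟩) j ≫= e
      simpa [q, IsColimit.map] using this⟩
    exact generatedBy_of_epi q (S.prop_colimit _ fun j => hT _)⟩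

/-- By (AB4*) a product of epimorphisms is epi, so a product of quotients of objects of `S` is a
quotient of their product. -/
lemma isClosedSubcategory_generatedBy [AB4Star X] [S.IsClosedUnderSubobjects]
    (hS : ∀ J : Type v, S.IsClosedUnderColimitsOfShape (Discrete J))
    (hS' : ∀ J : Type v, S.IsClosedUnderLimitsOfShape (Discrete J)) :
    IsClosedSubcategory.{v} (generatedBy S) where
  toIsWeaklyClosed := isWeaklyClosed_generatedBy hS
  products J := ⟨fun M ⟨P, hP⟩ => by
    choose T p hT hp using fun j => (generatedBy_iff hS).1 (hP j)
    have := hS' J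
    let α : Discrete.functor (fun j => T ⟨j⟩) ⟶ P.diag := Discrete.natTrans fun j => p j
    have : ∀ j, Epi (α.app j) := fun j => hp j
    have : Epi α := NatTrans.epi_of_epi_app α
    have := HasExactLimitsOfShape.preservesFiniteColimits (J := Discrete J) (C := X)
    let e := (limit.isLimit P.diag).conePointUniqueUpToIso P.isLimit
    exact generatedBy_of_epi (lim.map α ≫ e.hom) (S.prop_limit _ fun j => hT _)⟩

end Generated

/-! ### Torsionfree objects -/

section TorsionFree

variable {X : Type u} [Category.{v} X] [Abelian X]

/-- The image of a morphism from an object of `Y` is again in `Y`. Vanishing of morphisms, unlike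
the condition on subobjects, passes to limits at once. -/
lemma torsionFree_iff (Y : ObjectProperty X) [Y.IsClosedUnderQuotients] {M : X} :
    Y.torsionFree M ↔ ∀ (K : X) (f : K ⟶ M), Y K → f = 0 := by
  refine ⟨fun h K f hK => ?_, fun h K i _ hK => ?_⟩
  · have := h _ (Abelian.image.ι f) (Y.prop_of_epi (Abelian.factorThruImage f) hK)
    rw [← Abelian.image.fac f, this.eq_of_tgt (Abelian.factorThruImage f) 0, zero_comp]
  · exact IsZero.of_mono_eq_zero i (h K i hK)

instance (Y : ObjectProperty X) : Y.torsionFree.IsClosedUnderSubobjects where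
  prop_of_mono f _ h K i _ hK := h K (i ≫ f) hK

lemma torsionFree_limits (Y : ObjectProperty X) [Y.IsClosedUnderQuotients] (J : Type w)
    [Category J] : Y.torsionFree.IsClosedUnderLimitsOfShape J :=
  ⟨fun M ⟨P, hP⟩ => (Y.torsionFree_iff).2 fun K f hK => P.isLimit.hom_ext fun j => by
    simpa using Y.torsionFree_iff.1 (hP j) K (f ≫ P.π.app j) hK⟩

/-- In a Grothendieck category, a morphism from a coproduct is mono as soon as the summands have
orthogonal retractions, e.g. the canonical morphism from a coproduct to the product. -/
lemma mono_sigmaDesc [IsGrothendieckAbelian.{v} X] {J : Type v} (K : J → X) {P : X}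
    (i : ∀ j, K j ⟶ P) (p : ∀ j, P ⟶ K j) (h₁ : ∀ j, i j ≫ p j = 𝟙 _)
    (h₂ : ∀ j j', j ≠ j' → i j ≫ p j' = 0) : Mono (Limits.Sigma.desc i) := by
  classical
  -- The coproduct is the filtered colimit of its finite subcoproducts. Each of these is a split
  -- subobject of `P`, and filtered colimits preserve monomorphisms.
  let α : CoproductsFromFiniteFiltered.liftToFinsetObj (Discrete.functor K) ⟶
      (Functor.const _).obj P :=
    { app s := Limits.Sigma.desc fun x => i x.1.as
      naturality s t f := by
        refine Limits.Sigma.hom_ext _ _ fun x => ?_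
        erw [Limits.Sigma.ι_desc_assoc, Limits.Sigma.ι_desc, Category.comp_id,
          Limits.Sigma.ι_desc] }
  have (s : Finset (Discrete J)) : Mono (α.app s) := by
    let r : P ⟶ ∐ fun x : s => K x.1.as :=
      ∑ x : s, p x.1.as ≫ Limits.Sigma.ι (fun x : s => K x.1.as) x
    have hr : (Limits.Sigma.desc fun x : s => i x.1.as) ≫ r = 𝟙 _ := by
      refine Limits.Sigma.hom_ext _ _ fun y => ?_
      dsimp only [r]
      rw [Limits.Sigma.ι_desc_assoc, Preadditive.comp_sum, Finset.sum_eq_single y]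
      · rw [reassoc_of% (h₁ y.1.as), Category.comp_id]
      · intro x _ hx
        rw [reassoc_of% (h₂ y.1.as x.1.as fun h => hx (Subtype.ext (Discrete.ext h.symm))),
          zero_comp]
      · simp
    exact (SplitMono.mk r hr).mono
  have := NatTrans.mono_of_mono_app α
  refine colim.map_mono' α (CoproductsFromFiniteFiltered.isColimitFiniteSubproductsCocone K)
    (isColimitConstCocone _ P) _ fun s => ?_
  refine Limits.Sigma.hom_ext _ _ fun x => ?_
  erw [Limits.Sigma.ι_desc_assoc, Limits.Sigma.ι_desc, Category.comp_id, Limits.Sigma.ι_desc]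

/-- The coproduct embeds in the product, which is torsionfree. -/
lemma torsionFree_coproducts [IsGrothendieckAbelian.{v} X] (Y : ObjectProperty X)
    [Y.IsClosedUnderQuotients] (J : Type v) :
    Y.torsionFree.IsClosedUnderColimitsOfShape (Discrete J) := by
  classical
  refine ⟨fun M ⟨P, hP⟩ => ?_⟩
  have := Y.torsionFree_limits (Discrete J)
  let e : P.diag ≅ Discrete.functor fun j => P.diag.obj ⟨j⟩ := Discrete.natIsoFunctor
  let K j := P.diag.obj ⟨j⟩
  have h := mono_sigmaDesc K (Pi.ι K) (Pi.π K) (Pi.ι_π_eq_id K) fun _ _ => Pi.ι_π_of_ne K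
  have h' := Y.torsionFree.prop_of_mono (Limits.Sigma.desc (Pi.ι K))
    (Y.torsionFree.prop_pi K fun j => hP ⟨j⟩)
  exact Y.torsionFree.prop_of_iso
    (P.isColimit.coconePointsIsoOfNatIso (colimit.isColimit _) e).symm h'

end TorsionFree

/-! ### The section functor and the image of an essentially stable subcategory -/

section SectionFunctor

variable {X : Type u} [Category.{v} X] [Abelian X] [IsGrothendieckAbelian.{v} X]
  (Y : ObjectProperty X) [Y.IsLocalizing]

instance isIso_quotientSectionAdjunction_counit : IsIso Y.quotientSectionAdjunction.counit := by
  let adj := Y.quotientSectionAdjunction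
  let L := Y.quotientFunctor
  have := Localization.essSurj L Y.isoModSerre
  -- `π` applied to the unit descends to `X/Y`; by the triangle identities the result is inverse to
  -- the counit.
  let σ : 𝟭 Y.QuotientCategory ⟶ Y.sectionFunctor ⋙ L :=
    Localization.liftNatTrans L Y.isoModSerre L (L ⋙ Y.sectionFunctor ⋙ L) _ _
      (Functor.whiskerRight adj.unit L)
  have hσ (M : X) : σ.app (L.obj M) = L.map (adj.unit.app M) := by
    simp [σ, Localization.liftNatTrans_app, Localization.Lifting.iso]
  have h : ∀ T, IsIso (adj.counit.app T) := fun T => by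
    refine ⟨σ.app T, ?_, ?_⟩
    · have := σ.naturality (adj.counit.app T)
      dsimp at this ⊢
      rw [this, hσ, ← Functor.map_comp, adj.right_triangle_components]
      exact L.map_id _
    · have h₁ : σ.app (L.obj (L.objPreimage T)) ≫ adj.counit.app _ = 𝟙 _ := by
        rw [hσ]
        exact adj.left_triangle_components _
      rw [← cancel_epi (L.objObjPreimageIso T).hom]
      have h₂ := (σ ≫ adj.counit).naturality (L.objObjPreimageIso T).hom
      simp only [NatTrans.comp_app, h₁] at h₂
      simpa using h₂
  exact NatIso.isIso_of_isIso_app _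

instance : Y.sectionFunctor.Full := Y.quotientSectionAdjunction.fullyFaithfulROfIsIsoCounit.full

instance : Y.sectionFunctor.Faithful :=
  Y.quotientSectionAdjunction.fullyFaithfulROfIsIsoCounit.faithful

noncomputable instance : Reflective Y.sectionFunctor where
  L := Y.quotientFunctor
  adj := Y.quotientSectionAdjunction

instance : PreservesLimitsOfSize.{v, v} Y.sectionFunctor :=
  Y.quotientSectionAdjunction.rightAdjoint_preservesLimits

instance : Y.sectionFunctor.PreservesMonomorphisms :=
  Functor.preservesMonomorphisms_of_adjunction Y.quotientSectionAdjunction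

instance : Y.quotientFunctor.PreservesMonomorphisms :=
  SerreClassLocalization.preservesMonomorphisms Y.quotientFunctor Y

instance : Y.quotientFunctor.PreservesEpimorphisms :=
  SerreClassLocalization.preservesEpimorphisms Y.quotientFunctor Y

instance : HasLimitsOfSize.{v, v} Y.QuotientCategory :=
  hasLimits_of_reflective Y.sectionFunctor

/-- The isomorphism `π(ω(T)) ≅ T`. -/
noncomputable def quotientSectionIso (T : Y.QuotientCategory) :
    Y.quotientFunctor.obj (Y.sectionFunctor.obj T) ≅ T :=
  asIso (Y.quotientSectionAdjunction.counit.app T)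

lemma torsionFree_sectionFunctor_obj (T : Y.QuotientCategory) :
    Y.torsionFree (Y.sectionFunctor.obj T) := by
  rw [torsionFree_iff]
  intro K f hK
  have h := (SerreClassLocalization.isZero_obj_iff Y.quotientFunctor Y K).2 hK
  exact (Y.quotientSectionAdjunction.homEquiv K T).symm.injective (h.eq_of_src _ _)

/-- `π` makes the unit invertible, so its kernel lies in `Y` and vanishes when `M` is torsionfree.
-/
lemma mono_unit_app {M : X} (hM : Y.torsionFree M) :
    Mono (Y.quotientSectionAdjunction.unit.app M) := by
  have : Mono (Y.quotientFunctor.map (Y.quotientSectionAdjunction.unit.app M)) := inferInstance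
  rw [SerreClassLocalization.mono_map_iff Y.quotientFunctor Y] at this
  exact Preadditive.mono_of_kernel_zero ((hM _ (kernel.ι _) this).eq_of_src _ _)

/-- An essentially stable subcategory contains `ω(T)` for `T` in its image in `X/Y`. -/
lemma prop_sectionFunctor_obj {Z : ObjectProperty X} [Z.IsClosedUnderIsomorphisms]
    (hZ : Y.IsEssentiallyStable Z) {T : Y.QuotientCategory} (hT : Y.quotientImage Z T) :
    Z (Y.sectionFunctor.obj T) := by
  obtain ⟨M, hM, ⟨e⟩⟩ := hT
  exact Z.prop_of_iso (Y.sectionFunctor.mapIso e) (hZ M hM)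

lemma quotientImage_of_prop_sectionFunctor_obj {Z : ObjectProperty X} {T : Y.QuotientCategory}
    (hT : Z (Y.sectionFunctor.obj T)) : Y.quotientImage Z T :=
  ⟨_, hT, ⟨Y.quotientSectionIso T⟩⟩

theorem isClosedSubcategory_quotientImage {Z : ObjectProperty X}
    [hZ : IsClosedSubcategory.{v} Z] (hs : Y.IsEssentiallyStable Z) :
    IsClosedSubcategory.{v} (Y.quotientImage Z) := by
  have := hZ.subobjects
  have := hZ.quotients
  exact
  { subobjects := ⟨fun f _ hT => Y.quotientImage_of_prop_sectionFunctor_obj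
      (Z.prop_of_mono (Y.sectionFunctor.map f) (Y.prop_sectionFunctor_obj hs hT))⟩
    quotients := ⟨fun {S T} f _ ⟨M, hM, ⟨e⟩⟩ => by
      -- The image of the transpose `g : M ⟶ ω(T)` is a quotient of `M`, hence in `Z`. The
      -- comparison `c` from its image under `π` to `T` is mono, and epi because `f` factors through
      -- it up to `e`.
      let g := Y.quotientSectionAdjunction.homEquiv M T (e.hom ≫ f)
      let c := Y.quotientFunctor.map (Abelian.image.ι g) ≫ (Y.quotientSectionIso T).hom
      have hc : Y.quotientFunctor.map (Abelian.factorThruImage g) ≫ c = e.hom ≫ f := by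
        dsimp only [c]
        rw [← Functor.map_comp_assoc, Abelian.image.fac]
        exact (Y.quotientSectionAdjunction.homEquiv_counit ..).symm.trans
          ((Y.quotientSectionAdjunction.homEquiv M T).symm_apply_apply _)
      have : Epi (Y.quotientFunctor.map (Abelian.factorThruImage g) ≫ c) := by
        rw [hc]; infer_instance
      have : Epi c := epi_of_epi (Y.quotientFunctor.map (Abelian.factorThruImage g)) c
      have : Mono c := mono_comp _ _
      have : Balanced Y.QuotientCategory :=
        letI := SerreClassLocalization.abelian Y.quotientFunctor Y
        inferInstance
      have : IsIso c := isIso_of_mono_of_epi c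
      exact ⟨_, Z.prop_of_epi (Abelian.factorThruImage g) hM, ⟨asIso c⟩⟩⟩
    directSums J := ⟨fun T ⟨P, hP⟩ => by
      choose M hM e using hP
      have := hZ.directSums J
      let α : Discrete.functor (fun j => M ⟨j⟩) ⋙ Y.quotientFunctor ≅ P.diag :=
        Discrete.natIso fun j => (e j).some
      exact ⟨_, Z.prop_colimit (Discrete.functor fun j => M ⟨j⟩) fun j => hM _,
        ⟨(isColimitOfPreserves Y.quotientFunctor
          (colimit.isColimit _)).coconePointsIsoOfNatIso P.isColimit α⟩⟩⟩
    products J := ⟨fun T ⟨P, hP⟩ => by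
      have := hZ.products J
      exact Y.quotientImage_of_prop_sectionFunctor_obj
        (Z.prop_of_isLimit (isLimitOfPreserves Y.sectionFunctor P.isLimit)
          fun j => Y.prop_sectionFunctor_obj hs (hP j))⟩ }

/-! ### Lifting closed subcategories from the quotient, and the bijection -/

section Lift

variable (Z : ObjectProperty Y.QuotientCategory)

/-- The `Y`-torsionfree objects whose image in `X/Y` belongs to `Z`. -/
abbrev torsionFreePreimage : ObjectProperty X := Y.torsionFree ⊓ Z.inverseImage Y.quotientFunctor

lemma torsionFreePreimage_sectionFunctor_obj [Z.IsClosedUnderIsomorphisms]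
    {T : Y.QuotientCategory} (hT : Z T) : Y.torsionFreePreimage Z (Y.sectionFunctor.obj T) :=
  ⟨Y.torsionFree_sectionFunctor_obj T, Z.prop_of_iso (Y.quotientSectionIso T).symm hT⟩

omit [IsGrothendieckAbelian.{v} X] in
lemma torsionFreePreimage_subobjects [Z.IsClosedUnderSubobjects] :
    (Y.torsionFreePreimage Z).IsClosedUnderSubobjects where
  prop_of_mono f _ h := ⟨Y.torsionFree.prop_of_mono f h.1,
    Z.prop_of_mono (Y.quotientFunctor.map f) h.2⟩

lemma torsionFreePreimage_coproducts (J : Type v)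
    [Z.IsClosedUnderColimitsOfShape (Discrete J)] :
    (Y.torsionFreePreimage Z).IsClosedUnderColimitsOfShape (Discrete J) := by
  have := Y.torsionFree_coproducts J
  exact ⟨fun M ⟨P, hP⟩ => ⟨Y.torsionFree.prop_of_isColimit P.isColimit fun j => (hP j).1,
    Z.prop_of_isColimit (isColimitOfPreserves Y.quotientFunctor P.isColimit) fun j => (hP j).2⟩⟩

/-- `π` need not preserve products. Instead, the product of the `M j` embeds in the product of the
`ω(π(M j))`, which is `ω` of a product taken in `X/Y`. -/
lemma torsionFreePreimage_products [Z.IsClosedUnderSubobjects] (J : Type v)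
    [Z.IsClosedUnderLimitsOfShape (Discrete J)] :
    (Y.torsionFreePreimage Z).IsClosedUnderLimitsOfShape (Discrete J) := by
  have := Y.torsionFreePreimage_subobjects Z
  refine ⟨fun M ⟨P, hP⟩ => ?_⟩
  let G := P.diag ⋙ Y.quotientFunctor
  let η : P.diag ⟶ G ⋙ Y.sectionFunctor :=
    Functor.whiskerLeft P.diag Y.quotientSectionAdjunction.unit
  have : ∀ j, Mono (η.app j) := fun j => Y.mono_unit_app (hP j).1
  have hc := isLimitOfPreserves Y.sectionFunctor (limit.isLimit G)
  let q := hc.map (Cone.mk M P.π) η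
  have : Mono q := ⟨fun {W} g h e => P.isLimit.hom_ext fun j => by
    rw [← cancel_mono (η.app j)]
    have := e =≫ (Y.sectionFunctor.mapCone (limit.cone G)).π.app j
    simpa only [q, Category.assoc, IsLimit.map_π] using this⟩
  exact prop_of_mono _ q (Y.torsionFreePreimage_sectionFunctor_obj Z
    (Z.prop_limit G fun j => (hP j).2))

variable {Z}

lemma prop_quotientFunctor_obj_of_torsionFreeLift [hZ : IsWeaklyClosed.{v} Z] {M : X}
    (hM : Y.torsionFreeLift Z M) : Z (Y.quotientFunctor.obj M) := by
  have := hZ.quotients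
  have := hZ.directSums
  obtain ⟨N, p, hN, _⟩ := (generatedBy_iff (fun J => Y.torsionFreePreimage_coproducts Z J)).1 hM
  exact Z.prop_of_epi (Y.quotientFunctor.map p) hN.2

theorem isRelativelyClosed_torsionFreeLift [AB4Star X] [hZ : IsClosedSubcategory.{v} Z] :
    Y.IsRelativelyClosed (Y.torsionFreeLift Z) := by
  have := hZ.subobjects
  have := hZ.directSums
  have := hZ.products
  have := Y.torsionFreePreimage_subobjects Z
  have hcl : IsClosedSubcategory.{v} (Y.torsionFreeLift Z) :=
    isClosedSubcategory_generatedBy (fun J => Y.torsionFreePreimage_coproducts Z J)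
      (fun J => Y.torsionFreePreimage_products Z J)
  exact
  { closed := hcl
    essentiallyStable M hM := le_generatedBy _ _ (Y.torsionFreePreimage_sectionFunctor_obj Z
      (Y.prop_quotientFunctor_obj_of_torsionFreeLift hM))
    torsionFreeGenerated := le_antisymm (generatedBy_le _ inf_le_right)
      (generatedBy_monotone (le_inf inf_le_left (le_generatedBy _))) }

theorem quotientImage_torsionFreeLift [hZ : IsWeaklyClosed.{v} Z] :
    Y.quotientImage (Y.torsionFreeLift Z) = Z := by
  have := hZ.subobjects
  refine le_antisymm ?_ fun T hT => Y.quotientImage_of_prop_sectionFunctor_obj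
    (le_generatedBy _ _ (Y.torsionFreePreimage_sectionFunctor_obj Z hT))
  rintro T ⟨M, hM, ⟨e⟩⟩
  exact Z.prop_of_iso e (Y.prop_quotientFunctor_obj_of_torsionFreeLift hM)

theorem torsionFreeLift_quotientImage {Z : ObjectProperty X} (hZ : Y.IsRelativelyClosed Z) :
    Y.torsionFreeLift (Y.quotientImage Z) = Z := by
  have := hZ.closed
  have := hZ.closed.subobjects
  refine le_antisymm (generatedBy_le _ fun M hM => ?_) ?_
  · have := Y.mono_unit_app hM.1
    -- Essential stability puts `ω(π(M))` in `Z`, and `M` is a subobject of it.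
    exact Z.prop_of_mono (Y.quotientSectionAdjunction.unit.app M)
      (Y.prop_sectionFunctor_obj hZ.essentiallyStable hM.2)
  · conv_lhs => rw [← hZ.torsionFreeGenerated]
    exact generatedBy_monotone fun M hM => ⟨hM.1, M, hM.2, ⟨Iso.refl _⟩⟩

end Lift

end SectionFunctor

end CategoryTheory.ObjectProperty

theorem theorem4p4 {X : Type u} [Category.{v} X] [Abelian X] [IsGrothendieckAbelian.{v} X]
    [AB4Star X] (Y : ObjectProperty X) [Y.IsLocalizing] :
    (∀ Z : ObjectProperty X, ObjectProperty.IsClosedSubcategory.{v} Z → Y.IsEssentiallyStable Z →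
      ObjectProperty.IsClosedSubcategory.{v} (Y.quotientImage Z)) ∧
    (∀ Z : ObjectProperty Y.QuotientCategory, ObjectProperty.IsClosedSubcategory.{v} Z →
      Y.IsRelativelyClosed (Y.torsionFreeLift Z)) ∧
    (∃ e : {Z : ObjectProperty X // Y.IsRelativelyClosed Z} ≃
        {Z : ObjectProperty Y.QuotientCategory // ObjectProperty.IsClosedSubcategory.{v} Z},
      (∀ Z, (e Z).1 = Y.quotientImage Z.1) ∧
      (∀ Z, (e.symm Z).1 = Y.torsionFreeLift Z.1)) := by
  refine ⟨fun Z hZ hs => Y.isClosedSubcategory_quotientImage hs,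
    fun Z hZ => Y.isRelativelyClosed_torsionFreeLift,
    { toFun Z := ⟨Y.quotientImage Z.1,
        have := Z.2.closed
        Y.isClosedSubcategory_quotientImage Z.2.essentiallyStable⟩
      invFun Z := ⟨Y.torsionFreeLift Z.1,
        have := Z.2
        Y.isRelativelyClosed_torsionFreeLift⟩
      left_inv Z := Subtype.ext (Y.torsionFreeLift_quotientImage Z.2)
      right_inv Z := Subtype.ext (have := Z.2; Y.quotientImage_torsionFreeLift) },
    fun _ => rfl, fun _ => rfl⟩
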